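/- \textbf{Theorem (Downward L\"owenheim--Skolem, many-sorted).} Let $\Sigma$ be a first-order many-sorted signature, consisting of a nonempty set $\mathcal{S}_\Sigma$ of sorts, a set $\mathcal{F}_\Sigma$ of function symbols and a set $\mathcal{P}_\Sigma$ of predicate symbols containing an equality symbol $=_\sigma$ for each sort $\sigma$, and let $|\Sigma| = |\mathcal{S}_\Sigma|+|\mathcal{F}_\Sigma|+|\mathcal{P}_\Sigma|$; no cardinality restriction on $\Sigma$ is made. Function and predicate symbols have finite arities, and every sort $\sigma$ is interpreted in a $\Sigma$-structure $\mathbb{A}$ by a nonempty set $\sigma^{\mathbb{A}}$, with $=_\sigma$ interpreted as identity. Let $\mathbb{A}$ be a $\Sigma$-structure, and write $\mathcal{S}_{\geq}=\{\sigma\in\mathcal{S}_\Sigma : |\sigma^{\mathbb{A}}|\geq\aleph_0\}$ and $\mathcal{S}_{<}=\mathcal{S}_\Sigma\setminus\mathcal{S}_{\geq}$. Let $\kappa$ be a cardinal with $\max\{\aleph_0,|\Sigma|\}\leq\kappa$ and $\kappa\leq|\sigma^{\mathbb{A}}|$ for every $\sigma\in\mathcal{S}_{\geq}$, and for each $\sigma\in\mathcal{S}_{\geq}$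 let $A_\sigma\subseteq\sigma^{\mathbb{A}}$ be a set with $|A_\sigma|\leq\kappa$. Then there is an elementary substructure $\mathbb{B}$ of $\mathbb{A}$ (that is, a substructure such that $(\mathbb{B},\nu)\vDash\varphi$ if and only if $(\mathbb{A},\nu)\vDash\varphi$ for all $\Sigma$-formulas $\varphi$ and all assignments $\nu$ on $\mathbb{B}$) such that $|\sigma^{\mathbb{B}}|=\kappa$ and $A_\sigma\subseteq\sigma^{\mathbb{B}}$ for every $\sigma\in\mathcal{S}_{\geq}$, and $\sigma^{\mathbb{B}}=\sigma^{\mathbb{A}}$ for every $\sigma\in\mathcal{S}_{<}$. -/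

import Mathlib

open Cardinal

universe u v

namespace ManySorted

/-- A many-sorted signature: a nonempty set of sorts, function symbols of arity
`(σ₁, …, σₙ, σ)` and predicate symbols of arity `(σ₁, …, σₙ)`, with `n ≥ 0`. `Preds` holds the
predicate symbols other than the equality symbols `=_σ`; equality of each sort is always part of
the language and is built into formulas. -/
structure Signature where
  Sorts : Type u
  sorts_nonempty : Nonempty Sorts
  Funcs : Type u
  funcArity : Funcs → ℕ
  funcDom : (f : Funcs) → Fin (funcArity f) → Sorts
  funcCod : Funcs → Sorts
  Preds : Type u
  predArity : Preds → ℕ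
  predDom : (P : Preds) → Fin (predArity P) → Sorts

/-- `|Σ|`: the number of sorts plus the number of function symbols plus the number of predicate
symbols, the latter including one equality symbol for every sort. -/
noncomputable def Signature.card (S : Signature.{u}) : Cardinal.{u} :=
  #S.Sorts + #S.Funcs + #(S.Sorts ⊕ S.Preds)

/-- Terms, indexed by their sort. The variables of sort `σ` are `var σ 0, var σ 1, …`. -/
inductive Term (S : Signature.{u}) : S.Sorts → Type u
  | var (σ : S.Sorts) (n : ℕ) : Term S σ
  | app (f : S.Funcs) (ts : (i : Fin (S.funcArity f)) → Term S (S.funcDom f i)) :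
      Term S (S.funcCod f)

/-- First-order formulas. In `all σ n φ` and `ex σ n φ` the bound variable is the `n`-th
variable of sort `σ`. -/
inductive Formula (S : Signature.{u}) : Type u
  | eq (σ : S.Sorts) (s t : Term S σ) : Formula S
  | rel (P : S.Preds) (ts : (i : Fin (S.predArity P)) → Term S (S.predDom P i)) : Formula S
  | neg (φ : Formula S) : Formula S
  | and (φ ψ : Formula S) : Formula S
  | or (φ ψ : Formula S) : Formula S
  | imp (φ ψ : Formula S) : Formula S
  | all (σ : S.Sorts) (n : ℕ) (φ : Formula S) : Formula S
  | ex (σ : S.Sorts) (n : ℕ) (φ : Formula S) : Formula S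

/-- A structure for a many-sorted signature; every sort is interpreted by a nonempty set. -/
structure Structure (S : Signature.{u}) where
  carrier : S.Sorts → Type v
  carrier_nonempty : ∀ σ, Nonempty (carrier σ)
  func : (f : S.Funcs) → ((i : Fin (S.funcArity f)) → carrier (S.funcDom f i)) →
    carrier (S.funcCod f)
  pred : (P : S.Preds) → ((i : Fin (S.predArity P)) → carrier (S.predDom P i)) → Prop

namespace Structure

variable {S : Signature.{u}}

/-- An assignment sends each variable of sort `σ` to an element of the domain of sort `σ`. -/
abbrev Assignment (A : Structure.{u, v} S) : Type (max u v) :=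
  (σ : S.Sorts) → ℕ → A.carrier σ

open Classical in
/-- The assignment that sends the `n`-th variable of sort `σ` to `a` and agrees with `ν` on all
other variables. -/
noncomputable def Assignment.update {A : Structure.{u, v} S} (ν : A.Assignment) (σ : S.Sorts)
    (n : ℕ) (a : A.carrier σ) : A.Assignment :=
  Function.update ν σ (Function.update (ν σ) n a)

/-- The value of a term under an assignment. -/
def eval (A : Structure.{u, v} S) (ν : A.Assignment) : {σ : S.Sorts} → Term S σ → A.carrier σ
  | _, .var σ n => ν σ n
  | _, .app f ts => A.func f (fun i => A.eval ν (ts i))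

/-- `A.Sat ν φ` means `(A, ν) ⊨ φ`. -/
def Sat (A : Structure.{u, v} S) : A.Assignment → Formula S → Prop
  | ν, .eq _ s t => A.eval ν s = A.eval ν t
  | ν, .rel P ts => A.pred P (fun i => A.eval ν (ts i))
  | ν, .neg φ => ¬ A.Sat ν φ
  | ν, .and φ ψ => A.Sat ν φ ∧ A.Sat ν ψ
  | ν, .or φ ψ => A.Sat ν φ ∨ A.Sat ν ψ
  | ν, .imp φ ψ => A.Sat ν φ → A.Sat ν ψ
  | ν, .all σ n φ => ∀ a : A.carrier σ, A.Sat (ν.update σ n a) φ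
  | ν, .ex σ n φ => ∃ a : A.carrier σ, A.Sat (ν.update σ n a) φ

end Structure

/-- A substructure of `A`: a nonempty subset of each domain, closed under all the functions. -/
structure Substructure {S : Signature.{u}} (A : Structure.{u, v} S) where
  carrier : (σ : S.Sorts) → Set (A.carrier σ)
  carrier_nonempty : ∀ σ, (carrier σ).Nonempty
  func_mem : ∀ (f : S.Funcs) (x : (i : Fin (S.funcArity f)) → A.carrier (S.funcDom f i)),
    (∀ i, x i ∈ carrier (S.funcDom f i)) → A.func f x ∈ carrier (S.funcCod f)

namespace Substructure

variable {S : Signature.{u}} {A : Structure.{u, v} S}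

/-- A substructure as a structure, with the restricted functions and predicates. -/
def toStructure (B : Substructure A) : Structure.{u, v} S where
  carrier σ := B.carrier σ
  carrier_nonempty σ := (B.carrier_nonempty σ).to_subtype
  func f x := ⟨A.func f (fun i => (x i).1), B.func_mem f _ (fun i => (x i).2)⟩
  pred P x := A.pred P (fun i => (x i).1)

/-- An assignment on a substructure of `A`, regarded as an assignment on `A`. -/
def liftAssignment (B : Substructure A) (ν : B.toStructure.Assignment) : A.Assignment :=
  fun σ n => (ν σ n).1

/-- `B` is an elementary substructure of `A`: for all formulas `φ` and all assignments `ν` on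
`B`, `(B, ν) ⊨ φ` if and only if `(A, ν) ⊨ φ`. -/
def IsElementary (B : Substructure A) : Prop :=
  ∀ (φ : Formula S) (ν : B.toStructure.Assignment),
    B.toStructure.Sat ν φ ↔ A.Sat (B.liftAssignment ν) φ

end Substructure

end ManySorted

/-! The proof is Skolem's argument, run on all sorts at once. The domains are glued into the single
set `Σ σ, A.carrier σ`, which carries a one-sorted language of Skolem functions. A subset closed
under these functions passes the Tarski–Vaught test (`isElementary_of_exists`), and it is closed
under the functions of `A` because `f(x) = y` has only one witness. There are at most `max ℵ₀ |Σ|`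
formulas, hence as many Skolem functions, so the closure of a set of size at most `κ` still has size
at most `κ` (`exists_isElementary_of_le`). The generating set fixes the exact sizes: on an infinite
sort it is a superset of `X σ` of size `κ`, and on a finite sort it is the whole domain. -/

namespace ManySorted

variable {S : Signature.{u}}

/-! ### Counting terms and formulas by syntax trees -/

namespace Signature

/-- Node labels of the syntax trees of terms and formulas: variables, function symbols, predicate
symbols, equality symbols, connectives and the two quantifiers. -/
abbrev Label (S : Signature.{u}) : Type u :=
  (S.Sorts × ℕ) ⊕ S.Funcs ⊕ S.Preds ⊕ S.Sorts ⊕ Fin 4 ⊕ (S.Sorts × ℕ) ⊕ (S.Sorts × ℕ)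

/-- The number of children of a node of a syntax tree. -/
def labelArity : S.Label → ℕ
  | .inl _ => 0
  | .inr (.inl f) => S.funcArity f
  | .inr (.inr (.inl P)) => S.predArity P
  | .inr (.inr (.inr (.inl _))) => 2
  | .inr (.inr (.inr (.inr (.inl _)))) => 2
  | .inr (.inr (.inr (.inr (.inr (.inl _))))) => 1
  | .inr (.inr (.inr (.inr (.inr (.inr _))))) => 1

/-- Finitely branching trees over the labels of `S`. -/
abbrev Tree (S : Signature.{u}) : Type u := WType fun l : S.Label => Fin (labelArity l)

theorem card_sorts_le (S : Signature.{u}) : #S.Sorts ≤ S.card :=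
  le_self_add.trans le_self_add

theorem card_funcs_le (S : Signature.{u}) : #S.Funcs ≤ S.card :=
  le_add_self.trans le_self_add

theorem card_preds_le (S : Signature.{u}) : #S.Preds ≤ S.card := by
  refine le_trans ?_ (le_add_self : #(S.Sorts ⊕ S.Preds) ≤ S.card)
  exact mk_le_of_injective Sum.inr_injective

theorem mk_sorts_prod_nat_le (S : Signature.{u}) : #(S.Sorts × ℕ) ≤ max ℵ₀ S.card := by
  rw [mk_prod, lift_uzero, mk_nat, lift_aleph0]
  exact mul_le_of_le (le_max_left _ _) (S.card_sorts_le.trans (le_max_right _ _))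
    (le_max_left _ _)

theorem mk_sum_le {α : Type u} {β : Type v} {c : Cardinal.{max u v}} (hc : ℵ₀ ≤ c)
    (hα : lift.{v} #α ≤ c) (hβ : lift.{u} #β ≤ c) : #(α ⊕ β) ≤ c := by
  rw [mk_sum]
  exact add_le_of_le hc hα hβ

theorem mk_label_le (S : Signature.{u}) : #S.Label ≤ max ℵ₀ S.card := by
  have h0 : ℵ₀ ≤ max ℵ₀ S.card := le_max_left _ _
  have h1 : S.card ≤ max ℵ₀ S.card := le_max_right _ _
  have hv := S.mk_sorts_prod_nat_le
  have hfin : lift.{u} #(Fin 4) ≤ max ℵ₀ S.card :=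
    (lift_le_aleph0.2 mk_le_aleph0).trans h0
  refine mk_sum_le h0 (by rwa [lift_id]) ?_
  rw [lift_id]
  refine mk_sum_le h0 (by rw [lift_id]; exact S.card_funcs_le.trans h1) ?_
  rw [lift_id]
  refine mk_sum_le h0 (by rw [lift_id]; exact S.card_preds_le.trans h1) ?_
  rw [lift_id]
  refine mk_sum_le h0 (by rw [lift_id]; exact S.card_sorts_le.trans h1) ?_
  rw [lift_id]
  refine mk_sum_le h0 hfin ?_
  rw [lift_uzero]
  exact mk_sum_le h0 (by rwa [lift_id]) (by rwa [lift_id])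

theorem mk_tree_le (S : Signature.{u}) : #S.Tree ≤ max ℵ₀ S.card :=
  (WType.cardinalMk_le_max_aleph0_of_finite' (α := S.Label)).trans
    (max_le (by rw [lift_uzero]; exact S.mk_label_le) (le_max_left _ _))

end Signature

/-- The syntax tree of a term. -/
def Term.tree : {σ : S.Sorts} → Term S σ → S.Tree
  | _, .var σ n => ⟨.inl (σ, n), Fin.elim0⟩
  | _, .app f ts => ⟨.inr (.inl f), fun i => (ts i).tree⟩

/-- The root label determines the sort, so the two sorts may differ a priori; this lets the
induction avoid transport along equalities of sorts. -/
theorem Term.tree_injective_sigma {σ τ : S.Sorts} (s : Term S σ) (t : Term S τ)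
    (h : s.tree = t.tree) : (⟨σ, s⟩ : Σ σ, Term S σ) = ⟨τ, t⟩ := by
  induction s generalizing τ t with
  | var σ n =>
    cases t with
    | var τ m => cases (WType.mk.inj h).1; rfl
    | app g us => cases (WType.mk.inj h).1
  | app f ts ih =>
    cases t with
    | var τ m => cases (WType.mk.inj h).1
    | app g us =>
      obtain ⟨hl, h⟩ := WType.mk.inj h
      cases hl
      have h := eq_of_heq h
      obtain rfl : ts = us := funext fun i =>
        sigma_mk_injective (ih i (us i) (congrFun h i))
      rfl

theorem Term.tree_injective {σ : S.Sorts} :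
    Function.Injective (Term.tree : Term S σ → S.Tree) := fun s t h =>
  sigma_mk_injective (s.tree_injective_sigma t h)

/-- The syntax tree of a formula. -/
def Formula.tree : Formula S → S.Tree
  | .eq σ s t => ⟨.inr (.inr (.inr (.inl σ))), ![s.tree, t.tree]⟩
  | .rel P ts => ⟨.inr (.inr (.inl P)), fun i => (ts i).tree⟩
  -- The child is duplicated so that all four connectives share binary labels.
  | .neg φ => ⟨.inr (.inr (.inr (.inr (.inl 0)))), ![φ.tree, φ.tree]⟩
  | .and φ ψ => ⟨.inr (.inr (.inr (.inr (.inl 1)))), ![φ.tree, ψ.tree]⟩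
  | .or φ ψ => ⟨.inr (.inr (.inr (.inr (.inl 2)))), ![φ.tree, ψ.tree]⟩
  | .imp φ ψ => ⟨.inr (.inr (.inr (.inr (.inl 3)))), ![φ.tree, ψ.tree]⟩
  | .all σ n φ => ⟨.inr (.inr (.inr (.inr (.inr (.inl (σ, n)))))), fun _ => φ.tree⟩
  | .ex σ n φ => ⟨.inr (.inr (.inr (.inr (.inr (.inr (σ, n)))))), fun _ => φ.tree⟩

theorem Formula.tree_injective : Function.Injective (Formula.tree : Formula S → S.Tree) := by
  intro φ
  induction φ with
  | eq σ s t =>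
    rintro (_ | _ | _ | _ | _ | _ | _ | _) h <;>
      -- Distinct root labels exclude every constructor but the matching one.
      obtain ⟨hl, h⟩ := WType.mk.inj h <;> simp at hl
    subst hl
    have h := eq_of_heq h
    rw [Term.tree_injective (congrFun h (0 : Fin 2)),
      Term.tree_injective (congrFun h (1 : Fin 2))]
  | rel P ts =>
    rintro (_ | _ | _ | _ | _ | _ | _ | _) h <;>
      obtain ⟨hl, h⟩ := WType.mk.inj h <;> simp at hl
    subst hl
    have h := eq_of_heq h
    exact congrArg _ (funext fun i => Term.tree_injective (congrFun h i))
  | neg φ ih =>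
    rintro (_ | _ | _ | _ | _ | _ | _ | _) h <;>
      obtain ⟨hl, h⟩ := WType.mk.inj h <;> simp at hl
    rw [ih (congrFun (eq_of_heq h) (0 : Fin 2))]
  | and φ ψ ih₁ ih₂ | or φ ψ ih₁ ih₂ | imp φ ψ ih₁ ih₂ =>
    rintro (_ | _ | _ | _ | _ | _ | _ | _) h <;>
      obtain ⟨hl, h⟩ := WType.mk.inj h <;> simp at hl
    rw [ih₁ (congrFun (eq_of_heq h) (0 : Fin 2)), ih₂ (congrFun (eq_of_heq h) (1 : Fin 2))]
  | all σ n φ ih | ex σ n φ ih =>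
    rintro (_ | _ | _ | _ | _ | _ | _ | _) h <;>
      obtain ⟨hl, h⟩ := WType.mk.inj h <;> simp at hl
    obtain ⟨rfl, rfl⟩ := hl
    rw [ih (congrFun (eq_of_heq h) (0 : Fin 1))]

theorem Formula.mk_le (S : Signature.{u}) : #(Formula S) ≤ max ℵ₀ S.card :=
  (mk_le_of_injective Formula.tree_injective).trans S.mk_tree_le

/-! ### Dependence on finitely many variables -/

namespace Structure

variable {A : Structure.{u, v} S}

theorem Assignment.update_same (ν : A.Assignment) (σ : S.Sorts) (n : ℕ) (a : A.carrier σ) :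
    ν.update σ n a σ n = a := by
  simp [Assignment.update]

theorem Assignment.update_of_ne (ν : A.Assignment) {σ τ : S.Sorts} {n m : ℕ} (a : A.carrier σ)
    (h : (τ, m) ≠ (σ, n)) : ν.update σ n a τ m = ν τ m := by
  by_cases hσ : τ = σ
  · subst hσ
    have hm : m ≠ n := fun hm => h (by rw [hm])
    simp [Assignment.update, hm]
  · simp [Assignment.update, hσ]

/-- Because of this, the finite set of relevant variables need not drop the bound variable at a
quantifier. -/
theorem Assignment.update_congr {ν ν' : A.Assignment} {τ : S.Sorts} {m : ℕ}
    (h : ν τ m = ν' τ m) (σ : S.Sorts) (n : ℕ) (a : A.carrier σ) :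
    ν.update σ n a τ m = ν'.update σ n a τ m := by
  by_cases hp : (τ, m) = (σ, n)
  · cases hp
    rw [update_same, update_same]
  · rw [update_of_ne _ _ hp, update_of_ne _ _ hp, h]

/-- The value of a term depends on finitely many variables. -/
theorem exists_finite_eval_congr (A : Structure.{u, v} S) {σ : S.Sorts} (t : Term S σ) :
    ∃ F : Set (S.Sorts × ℕ), F.Finite ∧ ∀ ν ν' : A.Assignment,
      (∀ p ∈ F, ν p.1 p.2 = ν' p.1 p.2) → A.eval ν t = A.eval ν' t := by
  induction t with
  | var σ n => exact ⟨{(σ, n)}, Set.finite_singleton _, fun ν ν' h => h _ rfl⟩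
  | app f ts ih =>
    choose F hF h using ih
    refine ⟨⋃ i, F i, Set.finite_iUnion hF, fun ν ν' hν => ?_⟩
    exact congrArg _ (funext fun i => h i ν ν' fun p hp => hν p (Set.mem_iUnion_of_mem i hp))

/-- The truth of a formula depends on finitely many variables. -/
theorem exists_finite_sat_congr (A : Structure.{u, v} S) (φ : Formula S) :
    ∃ F : Set (S.Sorts × ℕ), F.Finite ∧ ∀ ν ν' : A.Assignment,
      (∀ p ∈ F, ν p.1 p.2 = ν' p.1 p.2) → (A.Sat ν φ ↔ A.Sat ν' φ) := by
  induction φ with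
  | eq σ s t =>
    obtain ⟨F, hF, hs⟩ := A.exists_finite_eval_congr s
    obtain ⟨G, hG, ht⟩ := A.exists_finite_eval_congr t
    refine ⟨F ∪ G, hF.union hG, fun ν ν' h => ?_⟩
    simp only [Sat]
    rw [hs ν ν' fun p hp => h p (.inl hp), ht ν ν' fun p hp => h p (.inr hp)]
  | rel P ts =>
    choose F hF h using fun i => A.exists_finite_eval_congr (ts i)
    refine ⟨⋃ i, F i, Set.finite_iUnion hF, fun ν ν' hν => ?_⟩
    simp only [Sat]
    rw [funext fun i => h i ν ν' fun p hp => hν p (Set.mem_iUnion_of_mem i hp)]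
  | neg φ ih =>
    obtain ⟨F, hF, h⟩ := ih
    exact ⟨F, hF, fun ν ν' hν => not_congr (h ν ν' hν)⟩
  | and φ ψ ih₁ ih₂ | or φ ψ ih₁ ih₂ | imp φ ψ ih₁ ih₂ =>
    obtain ⟨F, hF, h₁⟩ := ih₁
    obtain ⟨G, hG, h₂⟩ := ih₂
    refine ⟨F ∪ G, hF.union hG, fun ν ν' h => ?_⟩
    simp only [Sat]
    rw [h₁ ν ν' fun p hp => h p (.inl hp), h₂ ν ν' fun p hp => h p (.inr hp)]
  | all σ n φ ih =>
    obtain ⟨F, hF, h⟩ := ih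
    exact ⟨F, hF, fun ν ν' hν => forall_congr' fun a =>
      h _ _ fun p hp => Assignment.update_congr (hν p hp) σ n a⟩
  | ex σ n φ ih =>
    obtain ⟨F, hF, h⟩ := ih
    exact ⟨F, hF, fun ν ν' hν => exists_congr fun a =>
      h _ _ fun p hp => Assignment.update_congr (hν p hp) σ n a⟩

end Structure

/-! ### The Tarski–Vaught test -/

namespace Substructure

variable {A : Structure.{u, v} S}

theorem eval_liftAssignment (B : Substructure A) (ν : B.toStructure.Assignment) {σ : S.Sorts}
    (t : Term S σ) : A.eval (B.liftAssignment ν) t = (B.toStructure.eval ν t).1 := by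
  induction t with
  | var σ n => rfl
  | app f ts ih => exact congrArg _ (funext ih)

theorem liftAssignment_update (B : Substructure A) (ν : B.toStructure.Assignment) (σ : S.Sorts)
    (n : ℕ) (b : B.toStructure.carrier σ) :
    B.liftAssignment (ν.update σ n b) = (B.liftAssignment ν).update σ n b.1 := by
  funext τ m
  by_cases hp : (τ, m) = (σ, n)
  · cases hp
    simp only [liftAssignment, Structure.Assignment.update_same]
  · simp only [liftAssignment, Structure.Assignment.update_of_ne _ _ hp]

/-- The Tarski–Vaught test. -/
theorem isElementary_of_exists (B : Substructure A)
    (h : ∀ (φ : Formula S) (σ : S.Sorts) (n : ℕ) (ν : B.toStructure.Assignment),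
      (∃ a, A.Sat ((B.liftAssignment ν).update σ n a) φ) →
        ∃ b : B.carrier σ, A.Sat ((B.liftAssignment ν).update σ n b.1) φ) :
    B.IsElementary := by
  intro φ
  induction φ with
  | eq σ s t =>
    intro ν
    simp only [Structure.Sat, eval_liftAssignment]
    exact Subtype.ext_iff
  | rel P ts =>
    intro ν
    simp only [Structure.Sat, eval_liftAssignment]
    rfl
  | neg φ ih => exact fun ν => not_congr (ih ν)
  | and φ ψ ih₁ ih₂ => exact fun ν => and_congr (ih₁ ν) (ih₂ ν)
  | or φ ψ ih₁ ih₂ => exact fun ν => or_congr (ih₁ ν) (ih₂ ν)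
  | imp φ ψ ih₁ ih₂ => exact fun ν => imp_congr (ih₁ ν) (ih₂ ν)
  | all σ n φ ih =>
    intro ν
    simp only [Structure.Sat, ih, liftAssignment_update]
    refine ⟨fun hB => ?_, fun hA b => hA b.1⟩
    by_contra hA
    obtain ⟨a, ha⟩ := not_forall.1 hA
    -- A counterexample to `φ` is a witness for its negation.
    obtain ⟨b, hb⟩ := h (.neg φ) σ n ν ⟨a, ha⟩
    exact hb (hB b)
  | ex σ n φ ih =>
    intro ν
    simp only [Structure.Sat, ih, liftAssignment_update]
    exact ⟨fun ⟨b, hb⟩ => ⟨b.1, hb⟩, h φ σ n ν⟩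

end Substructure

/-! ### Skolem functions and Skolem hulls -/

/-- A one-sorted language with a `k`-ary Skolem function for every formula, every variable to be
witnessed and every list of `k` parameter variables. -/
def skolemLanguage (S : Signature.{u}) : FirstOrder.Language.{u, 0} where
  Functions k := (Formula S × S.Sorts × ℕ) × (Fin k → S.Sorts × ℕ)
  Relations _ := Empty

theorem mk_skolemLanguage_functions_le (S : Signature.{u}) :
    #(Σ k, (skolemLanguage S).Functions k) ≤ max ℵ₀ S.card := by
  have h0 : ℵ₀ ≤ max ℵ₀ S.card := le_max_left _ _
  -- The length of the parameter list recovers the arity `k`.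
  let f : (Σ k, (skolemLanguage S).Functions k) →
      (Formula S × S.Sorts × ℕ) × List (S.Sorts × ℕ) :=
    fun x => (x.2.1, List.ofFn x.2.2)
  have hf : Function.Injective f := by
    rintro ⟨k, a, b⟩ ⟨l, c, d⟩ h
    obtain ⟨h₁, h₂⟩ := Prod.mk.inj h
    obtain rfl : a = c := h₁
    cases List.ofFn_inj'.1 h₂
    rfl
  refine (mk_le_of_injective hf).trans ?_
  rw [mk_prod, lift_id, lift_id, mk_prod, lift_id, lift_id]
  refine mul_le_of_le h0 (mul_le_of_le h0 (Formula.mk_le S) S.mk_sorts_prod_nat_le) ?_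
  exact (mk_list_le_max _).trans (max_le h0 S.mk_sorts_prod_nat_le)

namespace Structure

variable (A : Structure.{u, v} S)

open Classical in
/-- The assignment that sends the variable `p i` to the value `x i`, when the sorts match, and
every other variable to its value under `ν`. -/
noncomputable def Assignment.override {A : Structure.{u, v} S} (ν : A.Assignment) {k : ℕ}
    (p : Fin k → S.Sorts × ℕ) (x : Fin k → Σ σ, A.carrier σ) : A.Assignment :=
  fun σ n => if h : ∃ a : A.carrier σ, ∃ i, p i = (σ, n) ∧ x i = ⟨σ, a⟩ then h.choose else ν σ n

/-- A default assignment. -/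
noncomputable def baseAssignment : A.Assignment :=
  fun σ _ => (A.carrier_nonempty σ).some

open Classical in
/-- An element witnessing `∃ x, φ` under `ν`, where `x` is the `n`-th variable of sort `σ`. -/
noncomputable def witness (ν : A.Assignment) (φ : Formula S) (σ : S.Sorts) (n : ℕ) :
    A.carrier σ :=
  if h : ∃ a, A.Sat (ν.update σ n a) φ then h.choose else (A.carrier_nonempty σ).some

theorem sat_witness {ν : A.Assignment} {φ : Formula S} {σ : S.Sorts} {n : ℕ}
    (h : ∃ a, A.Sat (ν.update σ n a) φ) : A.Sat (ν.update σ n (A.witness ν φ σ n)) φ := by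
  rw [witness, dif_pos h]
  exact h.choose_spec

theorem Assignment.override_apply {A : Structure.{u, v} S} (ν μ : A.Assignment) {k : ℕ}
    (p : Fin k → S.Sorts × ℕ) (i : Fin k) :
    μ.override p (fun j => ⟨(p j).1, ν (p j).1 (p j).2⟩) (p i).1 (p i).2 = ν (p i).1 (p i).2 := by
  have h : ∃ a : A.carrier (p i).1, ∃ j, p j = ((p i).1, (p i).2) ∧
      (⟨(p j).1, ν (p j).1 (p j).2⟩ : Σ σ, A.carrier σ) = ⟨(p i).1, a⟩ :=
    ⟨_, i, rfl, rfl⟩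
  rw [override, dif_pos h]
  obtain ⟨j, hj, hx⟩ := h.choose_spec
  have hj : p j = p i := hj
  rw [hj] at hx
  exact (sigma_mk_injective hx).symm

/-- The elements of all sorts of `A`, with the Skolem functions. -/
@[reducible]
noncomputable def skolemStructure : (skolemLanguage S).Structure (Σ σ, A.carrier σ) where
  funMap {_} f x := ⟨f.1.2.1, A.witness (A.baseAssignment.override f.2 x) f.1.1 f.1.2.1 f.1.2.2⟩
  RelMap r _ := r.elim

/-- A set of elements of `A` closed under the Skolem functions contains witnesses for all
formulas with parameters in the set. -/
theorem exists_mem_sat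
    (C : @FirstOrder.Language.Substructure (skolemLanguage S) (Σ σ, A.carrier σ)
      A.skolemStructure)
    (ν : A.Assignment) (hν : ∀ σ n, (⟨σ, ν σ n⟩ : Σ σ, A.carrier σ) ∈ C)
    (φ : Formula S) (σ : S.Sorts) (n : ℕ) (h : ∃ a, A.Sat (ν.update σ n a) φ) :
    ∃ a : A.carrier σ, (⟨σ, a⟩ : Σ σ, A.carrier σ) ∈ C ∧ A.Sat (ν.update σ n a) φ := by
  let _ := A.skolemStructure
  obtain ⟨F, hF, hφ⟩ := A.exists_finite_sat_congr φ
  obtain ⟨k, p, hp⟩ := hF.fin_embedding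
  let x : Fin k → Σ σ, A.carrier σ := fun j => ⟨(p j).1, ν (p j).1 (p j).2⟩
  -- `μ` agrees with `ν` on the variables relevant to `φ`, and its witness is a Skolem function
  -- value at `x`.
  let μ := A.baseAssignment.override p x
  have hμ (a : A.carrier σ) : A.Sat (μ.update σ n a) φ ↔ A.Sat (ν.update σ n a) φ := by
    refine hφ _ _ fun q hq => Assignment.update_congr ?_ σ n a
    rw [← hp] at hq
    obtain ⟨i, rfl⟩ := hq
    exact Assignment.override_apply ν A.baseAssignment p i
  simp only [← hμ] at h ⊢
  exact ⟨A.witness μ φ σ n,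
    C.fun_mem (n := k) (((φ, σ, n), p) : (skolemLanguage S).Functions k) x fun j => hν _ _,
    A.sat_witness h⟩

/-- A set closed under the Skolem functions is closed under the functions of `A`. -/
theorem func_mem_of_skolem
    (C : @FirstOrder.Language.Substructure (skolemLanguage S) (Σ σ, A.carrier σ)
      A.skolemStructure)
    (ν : A.Assignment) (hν : ∀ σ n, (⟨σ, ν σ n⟩ : Σ σ, A.carrier σ) ∈ C) (f : S.Funcs)
    (x : (i : Fin (S.funcArity f)) → A.carrier (S.funcDom f i))
    (hx : ∀ i, (⟨S.funcDom f i, x i⟩ : Σ σ, A.carrier σ) ∈ C) :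
    (⟨S.funcCod f, A.func f x⟩ : Σ σ, A.carrier σ) ∈ C := by
  classical
  let μ : A.Assignment := fun σ n =>
    if h : ∃ hn : n < S.funcArity f, S.funcDom f ⟨n, hn⟩ = σ then h.2 ▸ x ⟨n, h.1⟩ else ν σ n
  have hμ : ∀ σ n, (⟨σ, μ σ n⟩ : Σ σ, A.carrier σ) ∈ C := by
    intro σ n
    by_cases h : ∃ hn : n < S.funcArity f, S.funcDom f ⟨n, hn⟩ = σ
    · obtain ⟨hn, rfl⟩ := h
      simpa [μ, hn] using hx ⟨n, hn⟩
    · simpa [μ, h] using hν σ n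
  have hμx (i : Fin (S.funcArity f)) : μ (S.funcDom f i) i = x i := by
    simp [μ]
  -- The index `S.funcArity f` exceeds those of the argument variables, so the output variable is
  -- fresh.
  let φ : Formula S := .eq (S.funcCod f) (.app f fun i => .var (S.funcDom f i) i)
    (.var (S.funcCod f) (S.funcArity f))
  have hφ (a : A.carrier (S.funcCod f)) :
      A.Sat (μ.update (S.funcCod f) (S.funcArity f) a) φ ↔ A.func f x = a := by
    simp only [φ, Sat, eval, Assignment.update_same]
    have : (fun i : Fin (S.funcArity f) =>
        μ.update (S.funcCod f) (S.funcArity f) a (S.funcDom f i) i) = x := by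
      funext i
      rw [Assignment.update_of_ne, hμx]
      exact fun h => i.2.ne (Prod.mk.inj h).2
    rw [this]
  obtain ⟨a, ha, hs⟩ := A.exists_mem_sat C μ hμ φ _ _ ⟨_, (hφ _).2 rfl⟩
  rwa [(hφ a).1 hs]

/-- A set closed under the Skolem functions and meeting every sort, as a substructure. -/
def substructureOfSkolem
    (C : @FirstOrder.Language.Substructure (skolemLanguage S) (Σ σ, A.carrier σ)
      A.skolemStructure)
    (hC : ∃ ν : A.Assignment, ∀ σ n, (⟨σ, ν σ n⟩ : Σ σ, A.carrier σ) ∈ C) : Substructure A where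
  carrier σ := {a | (⟨σ, a⟩ : Σ σ, A.carrier σ) ∈ C}
  carrier_nonempty σ := let ⟨ν, hν⟩ := hC; ⟨ν σ 0, hν σ 0⟩
  func_mem f x hx := let ⟨ν, hν⟩ := hC; A.func_mem_of_skolem C ν hν f x hx

theorem isElementary_substructureOfSkolem
    (C : @FirstOrder.Language.Substructure (skolemLanguage S) (Σ σ, A.carrier σ)
      A.skolemStructure)
    (hC : ∃ ν : A.Assignment, ∀ σ n, (⟨σ, ν σ n⟩ : Σ σ, A.carrier σ) ∈ C) :
    (A.substructureOfSkolem C hC).IsElementary := by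
  refine Substructure.isElementary_of_exists _ fun φ σ n ν h => ?_
  obtain ⟨a, ha, hs⟩ := A.exists_mem_sat C _ (fun σ n => (ν σ n).2) φ σ n h
  exact ⟨⟨a, ha⟩, hs⟩

/-- Every family of nonempty sets of size at most `κ` is contained in an elementary substructure
with all domains of size at most `κ`, if `κ` is at least `max ℵ₀ |Σ|`. -/
theorem exists_isElementary_of_le (κ : Cardinal.{max u v})
    (hκ : max ℵ₀ (Cardinal.lift.{v} S.card) ≤ κ) (Z : (σ : S.Sorts) → Set (A.carrier σ))
    (hne : ∀ σ, (Z σ).Nonempty) (hZ : ∀ σ, Cardinal.lift.{u} #(Z σ) ≤ κ) :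
    ∃ B : Substructure A, B.IsElementary ∧ ∀ σ, Z σ ⊆ B.carrier σ ∧
      Cardinal.lift.{u} #(B.carrier σ) ≤ κ := by
  let _ := A.skolemStructure
  obtain ⟨h0, h1⟩ := max_le_iff.1 hκ
  let s : Set (Σ σ, A.carrier σ) := {p | p.2 ∈ Z p.1}
  have hs : #s ≤ κ := by
    let f : s → Σ σ, Z σ := fun p => ⟨p.1.1, p.1.2, p.2⟩
    have hf : Function.Injective f := by
      rintro ⟨⟨σ, a⟩, ha⟩ ⟨⟨τ, b⟩, hb⟩ h
      cases h
      rfl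
    refine (mk_le_of_injective hf).trans ?_
    -- The bound `|Σ| ≤ κ` also limits the number of sorts, so the union stays within `κ`.
    have hle : #(Σ σ, Z σ) ≤ Cardinal.lift.{v} #S.Sorts * κ := by
      rw [mk_sigma]
      calc Cardinal.sum (fun σ => #(Z σ))
          = Cardinal.sum (fun σ => Cardinal.lift.{u} #(Z σ)) := by
            rw [← mk_sigma]
            simp only [← mk_uLift]
            rw [← mk_sigma]
            exact mk_congr (Equiv.sigmaCongrRight fun _ => Equiv.ulift.symm)
        _ ≤ Cardinal.sum (fun _ : S.Sorts => κ) := Cardinal.sum_le_sum _ _ hZ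
        _ = _ := by rw [Cardinal.sum_const, Cardinal.lift_id'.{u, max u v}, Cardinal.lift_umax.{u, v}]
    exact hle.trans (mul_le_of_le h0 ((Cardinal.lift_le.2 S.card_sorts_le).trans h1) le_rfl)
  let C := FirstOrder.Language.Substructure.closure (skolemLanguage S) s
  have hsC : s ⊆ C := FirstOrder.Language.Substructure.subset_closure
  have hC : #C ≤ κ := by
    have h := FirstOrder.Language.Substructure.lift_card_closure_le (L := skolemLanguage S) (s := s)
    rw [Cardinal.lift_id'.{u, max u v}, Cardinal.lift_id'.{u, max u v}] at h
    refine h.trans (max_le h0 (add_le_of_le h0 hs ?_))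
    refine (Cardinal.lift_le.2 (mk_skolemLanguage_functions_le S)).trans ?_
    rw [Cardinal.lift_max, Cardinal.lift_aleph0, Cardinal.lift_umax]
    exact hκ
  have hν : ∃ ν : A.Assignment, ∀ σ n, (⟨σ, ν σ n⟩ : Σ σ, A.carrier σ) ∈ C :=
    ⟨fun σ _ => (hne σ).some, fun σ _ => hsC (hne σ).some_mem⟩
  refine ⟨A.substructureOfSkolem C hν, A.isElementary_substructureOfSkolem C hν,
    fun σ => ⟨fun a ha => hsC (show (⟨σ, a⟩ : Σ σ, A.carrier σ) ∈ s from ha), ?_⟩⟩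
  refine le_trans ?_ hC
  rw [← mk_uLift]
  refine mk_le_of_injective
    (f := fun a : ULift.{u} ((A.substructureOfSkolem C hν).carrier σ) =>
      (⟨⟨σ, a.down.1⟩, a.down.2⟩ : C)) fun a b h => ?_
  exact ULift.down_injective (Subtype.ext (sigma_mk_injective (Subtype.mk.inj h)))

end Structure

/-! ### Adjusting the generating sets to size `κ` -/

/-- A set of size at most `κ` in a type of size at least `κ` extends to one of size `κ`. -/
theorem exists_superset_lift_mk_eq {α : Type v} {κ : Cardinal.{max u v}} (h0 : ℵ₀ ≤ κ)
    (hκ : κ ≤ Cardinal.lift.{u} #α) (X : Set α) (hX : Cardinal.lift.{u} #X ≤ κ) :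
    ∃ Z : Set α, X ⊆ Z ∧ Cardinal.lift.{u} #Z = κ := by
  -- Lying below a lifted cardinal, `κ` is itself a lift from the universe of `α`.
  obtain ⟨c, hc⟩ := Cardinal.mem_range_lift_of_le hκ
  subst hc
  obtain ⟨Y, hY⟩ := Cardinal.le_mk_iff_exists_set.1 (Cardinal.lift_le.1 hκ)
  refine ⟨X ∪ Y, Set.subset_union_left, le_antisymm (Cardinal.lift_le.2 ?_)
    (Cardinal.lift_le.2 ?_)⟩
  · exact (Cardinal.mk_union_le X Y).trans
      (add_le_of_le (Cardinal.aleph0_le_lift.1 h0) (Cardinal.lift_le.1 hX) hY.le)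
  · exact hY.ge.trans (Cardinal.mk_le_mk_of_subset Set.subset_union_right)

end ManySorted

theorem mainTheorem9 (S : ManySorted.Signature.{u}) (A : ManySorted.Structure.{u, v} S)
    (κ : Cardinal.{max u v})
    (hκ : max ℵ₀ (Cardinal.lift.{v} S.card) ≤ κ)
    (hκA : ∀ σ : S.Sorts, Infinite (A.carrier σ) → κ ≤ Cardinal.lift.{u} #(A.carrier σ))
    (X : (σ : S.Sorts) → Set (A.carrier σ))
    (hX : ∀ σ : S.Sorts, Infinite (A.carrier σ) → Cardinal.lift.{u} #(X σ) ≤ κ) :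
    ∃ B : ManySorted.Substructure A, B.IsElementary ∧
      (∀ σ : S.Sorts, Infinite (A.carrier σ) →
        Cardinal.lift.{u} #(B.carrier σ) = κ ∧ X σ ⊆ B.carrier σ) ∧
      (∀ σ : S.Sorts, Finite (A.carrier σ) → B.carrier σ = Set.univ) := by
  obtain ⟨h0, -⟩ := max_le_iff.1 hκ
  have hZ (σ : S.Sorts) : ∃ Z : Set (A.carrier σ), Z.Nonempty ∧ Cardinal.lift.{u} #Z ≤ κ ∧
      (Infinite (A.carrier σ) → X σ ⊆ Z ∧ Cardinal.lift.{u} #Z = κ) ∧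
      (Finite (A.carrier σ) → Z = Set.univ) := by
    rcases finite_or_infinite (A.carrier σ) with hσ | hσ
    · have := A.carrier_nonempty σ
      refine ⟨Set.univ, Set.univ_nonempty, le_trans ?_ h0,
        fun h => (not_finite_iff_infinite.2 h hσ).elim, fun _ => rfl⟩
      exact Cardinal.lift_le_aleph0.2 Cardinal.mk_le_aleph0
    · obtain ⟨Z, hXZ, hZ⟩ := ManySorted.exists_superset_lift_mk_eq h0 (hκA σ hσ) (X σ) (hX σ hσ)
      refine ⟨Z, ?_, hZ.le, fun _ => ⟨hXZ, hZ⟩, fun h => (not_finite_iff_infinite.2 hσ h).elim⟩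
      rw [← Set.nonempty_coe_sort, ← Cardinal.mk_ne_zero_iff]
      intro h
      rw [h, Cardinal.lift_zero] at hZ
      exact Cardinal.aleph0_ne_zero (le_antisymm (hZ ▸ h0) zero_le)
  choose Z hne hle hinf hfin using hZ
  obtain ⟨B, hB, hZB⟩ := A.exists_isElementary_of_le κ hκ Z hne hle
  refine ⟨B, hB, fun σ hσ => ⟨le_antisymm (hZB σ).2 ?_, (hinf σ hσ).1.trans (hZB σ).1⟩,
    fun σ hσ => Set.univ_subset_iff.1 (hfin σ hσ ▸ (hZB σ).1)⟩
  -- The lower bound holds because `Z σ` already has size `κ`.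
  rw [← (hinf σ hσ).2]
  exact Cardinal.lift_le.2 (Cardinal.mk_le_mk_of_subset (hZB σ).1)
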